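/- Let $\mathbb{F}_q$ be a finite field, $\mathcal{K}=\mathbb{F}_q((t))$, $\mathcal{O}=\mathbb{F}_q[[t]]$ and $G=PGL_2(\mathcal{K})$ with its usual (quotient) topology. Let $I^0\subset G$ be the subgroup of classes of matrices $\begin{pmatrix}1+ta&b\\tc&1+td\end{pmatrix}$ with $a,b,c,d\in\mathcal{O}$, let $\sigma\in G$ be the class of $\begin{pmatrix}0&1\\t&0\end{pmatrix}$, and let $A\subset G$ be the subgroup generated by $I^0$ and $\sigma$. Let $\psi:\mathbb{F}_q\to\mathbb{C}^\times$ be a nontrivial character of the additive group, and let $\chi:A\to\mathbb{C}^\times$ be the unique character with $\chi\begin{pmatrix}1+ta&b\\tc&1+td\end{pmatrix}=\psi(b_0+c_0)$ on $I^0$ and $\chi(\sigma)=1$, where $x_0$ denotes the constant term of $x\in\mathcal{O}$. Let $V=\mathrm{ind}_A^G\chi$ be the space of compactly supported functions $f:G\to\mathbb{C}$ that are invariant under right translation by some open subgroup and satisfy $f(ga)=\chi(a)f(g)$ for all $g\in G$, $a\in A$, with $G$ acting by $(h\cdot f)(g)=f(h^{-1}g)$. Then $V$ is an irreducible cuspidal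 representation of $G$. That is: $V\neq 0$ and $V$ has no $G$-stable subspaces other than $0$ and $V$; $V$ is admissible, i.e. smooth (every vector is fixed by an open subgroup) with the space of $H$-fixed vectors finite-dimensional for every open subgroup $H\subset G$; and every linear functional on $V$ that is invariant under $U(\mathcal{K})=\left\{\begin{pmatrix}1&u\\0&1\end{pmatrix}:u\in\mathcal{K}\right\}$ is zero. -/

import Mathlib

open scoped MatrixGroups PowerSeries LaurentSeries
open Matrix

/-! ### Smooth representations of topological groups -/

section Smooth

variable {G : Type*} [Group G] [TopologicalSpace G]
variable {V : Type*} [AddCommGroup V] [Module ℂ V]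

/-- A complex representation is smooth if every vector is fixed by some open subgroup. -/
def IsSmoothRep (ρ : Representation ℂ G V) : Prop :=
  ∀ v : V, ∃ U : Subgroup G, IsOpen (U : Set G) ∧ ∀ u ∈ U, ρ u v = v

/-- The space of vectors fixed by a subgroup `U`. -/
def fixedVectors (ρ : Representation ℂ G V) (U : Subgroup G) : Submodule ℂ V where
  carrier := {v | ∀ u ∈ U, ρ u v = v}
  add_mem' := by
    intro v w hv hw u hu
    rw [map_add, hv u hu, hw u hu]
  zero_mem' := by
    intro u _
    exact map_zero _
  smul_mem' := by
    intro c v hv u hu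
    rw [map_smul, hv u hu]

/-- A representation is admissible if it is smooth and the fixed vectors of every open subgroup
form a finite-dimensional space. -/
structure IsAdmissibleRep (ρ : Representation ℂ G V) : Prop where
  smooth : IsSmoothRep ρ
  finite_fixed : ∀ U : Subgroup G, IsOpen (U : Set G) → FiniteDimensional ℂ (fixedVectors ρ U)

/-- `C^∞(G)`: the functions `f : G → ℂ` that are invariant under right translation by some
open subgroup and are supported in a compact set. -/
def smoothCompactlySupported (G : Type*) [Group G] [TopologicalSpace G] :
    Submodule ℂ (G → ℂ) where
  carrier := {f | (∃ U : Subgroup G, IsOpen (U : Set G) ∧ ∀ g, ∀ u ∈ U, f (g * u) = f g) ∧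
    ∃ C : Set G, IsCompact C ∧ Function.support f ⊆ C}
  add_mem' := by
    rintro f g ⟨⟨U, hU, hf⟩, C, hC, hfC⟩ ⟨⟨U', hU', hg⟩, C', hC', hgC⟩
    refine ⟨⟨U ⊓ U', hU.inter hU', fun x u hu => ?_⟩, C ∪ C', hC.union hC', ?_⟩
    · rw [Pi.add_apply, Pi.add_apply, hf x u hu.1, hg x u hu.2]
    · exact (Function.support_add f g).trans (Set.union_subset_union hfC hgC)
  zero_mem' := ⟨⟨⊤, isOpen_univ, fun _ _ _ => rfl⟩, ∅, isCompact_empty, by simp⟩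
  smul_mem' := by
    rintro c f ⟨⟨U, hU, hf⟩, C, hC, hfC⟩
    refine ⟨⟨U, hU, fun x u hu => ?_⟩, C, hC, (Function.support_const_smul_subset c f).trans hfC⟩
    rw [Pi.smul_apply, Pi.smul_apply, hf x u hu]

/-- The space of compact induction from a character `χ` of a compact subgroup `A`: the functions
`f ∈ C^∞(G)` with `f (g a) = χ(a) f(g)` for `a ∈ A`. -/
def compactIndSpace (A : Subgroup G) (χ : A →* ℂ) : Submodule ℂ (G → ℂ) :=
  smoothCompactlySupported G ⊓
    { carrier := {f | ∀ (g : G) (a : A), f (g * a) = χ a * f g}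
      add_mem' := by
        intro f f' hf hf' g a
        rw [Pi.add_apply, Pi.add_apply, hf, hf', mul_add]
      zero_mem' := by
        intro g a
        simp
      smul_mem' := by
        intro c f hf g a
        rw [Pi.smul_apply, Pi.smul_apply, hf, smul_eq_mul, smul_eq_mul, mul_left_comm] }

theorem compactIndSpace_translate [IsTopologicalGroup G] {A : Subgroup G} {χ : A →* ℂ}
    (h : G) {f : G → ℂ} (hf : f ∈ compactIndSpace A χ) :
    (fun g => f (h⁻¹ * g)) ∈ compactIndSpace A χ := by
  obtain ⟨⟨⟨U, hU, hfU⟩, C, hC, hfC⟩, hχ⟩ := hf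
  refine ⟨⟨⟨U, hU, fun g u hu => ?_⟩, (fun g => h * g) '' C,
    hC.image (continuous_const_mul h), fun g hg => ?_⟩, fun g a => ?_⟩
  · simpa [mul_assoc] using hfU (h⁻¹ * g) u hu
  · exact ⟨h⁻¹ * g, hfC hg, by simp⟩
  · simpa [mul_assoc] using hχ (h⁻¹ * g) a

/-- The action of `G` on the compactly induced space by left translations,
`(h • f)(g) = f (h⁻¹ g)`. -/
def compactInd [IsTopologicalGroup G] (A : Subgroup G) (χ : A →* ℂ) :
    Representation ℂ G (compactIndSpace A χ) where
  toFun h :=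
    { toFun := fun f => ⟨fun g => f.1 (h⁻¹ * g), compactIndSpace_translate h f.2⟩
      map_add' := fun _ _ => rfl
      map_smul' := fun _ _ => rfl }
  map_one' := by
    ext f g
    simp
  map_mul' h h' := by
    ext f g
    simp [mul_assoc]

end Smooth

/-! ### The group `PGL₂(F((t)))` -/

/-- The topology of `PGL` is the quotient of the topology of `GL`. -/
instance pglTopologicalSpace {n : Type*} [Fintype n] [DecidableEq n] {R : Type*} [CommRing R]
    [TopologicalSpace R] : TopologicalSpace (ProjGenLinGroup n R) :=
  inferInstanceAs (TopologicalSpace (GL n R ⧸ Subgroup.center (GL n R)))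

instance pglIsTopologicalGroup {n : Type*} [Fintype n] [DecidableEq n] {R : Type*} [CommRing R]
    [TopologicalSpace R] [IsTopologicalRing R] : IsTopologicalGroup (ProjGenLinGroup n R) :=
  inferInstanceAs (IsTopologicalGroup (GL n R ⧸ Subgroup.center (GL n R)))

section Group

/-- The group of upper triangular unipotent matrices in `GL₂(R)`. -/
def unipotentGL (R : Type*) [CommRing R] : Subgroup (GL (Fin 2) R) where
  carrier := {M | ∃ u : R, M.1 = !![1, u; 0, 1]}
  mul_mem' := by
    rintro M N ⟨u, hM⟩ ⟨v, hN⟩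
    exact ⟨v + u, by simp [hM, hN]⟩
  one_mem' := ⟨0, by simp [Matrix.one_fin_two]⟩
  inv_mem' := by
    rintro M ⟨u, hM⟩
    refine ⟨-u, ?_⟩
    rw [Matrix.coe_units_inv, hM]
    simp [Matrix.inv_def, Matrix.adjugate_fin_two]

/-- The image `U(K)` of the upper triangular unipotent group in `PGL₂(K)`. -/
def unipotentPGL (K : Type*) [Field K] : Subgroup PGL(2, K) :=
  (unipotentGL K).map ProjGenLinGroup.mk

/-- A representation of `PGL₂(K)` is quasi-cuspidal if every `U(K)`-invariant linear functional on
it vanishes. -/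
def IsQuasiCuspidal {K : Type*} [Field K] {V : Type*} [AddCommGroup V] [Module ℂ V]
    (ρ : Representation ℂ PGL(2, K) V) : Prop :=
  ∀ l : V →ₗ[ℂ] ℂ, (∀ u ∈ unipotentPGL K, ∀ v : V, l (ρ u v) = l v) → l = 0

/-- A representation of `PGL₂(K)` is cuspidal if it is admissible and quasi-cuspidal. -/
structure IsCuspidalRep {K : Type*} [Field K] [TopologicalSpace K] {V : Type*} [AddCommGroup V]
    [Module ℂ V] (ρ : Representation ℂ PGL(2, K) V) : Prop where
  admissible : IsAdmissibleRep ρ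
  quasiCuspidal : IsQuasiCuspidal ρ

variable (F : Type*) [Field F]

/-- The map `GL₂(F[[t]]) → PGL₂(F((t)))`. -/
noncomputable def integralToPGL : GL (Fin 2) F⟦X⟧ →* PGL(2, F⸨X⸩) :=
  ProjGenLinGroup.mk.comp (GeneralLinearGroup.map (algebraMap F⟦X⟧ F⸨X⸩))

/-- The matrices in `GL₂(F[[t]])` whose value at `t = 0` is upper triangular unipotent. -/
noncomputable def iwahoriZeroGL : Subgroup (GL (Fin 2) F⟦X⟧) :=
  (unipotentGL F).comap (GeneralLinearGroup.map PowerSeries.constantCoeff)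

variable {F}

theorem mem_iwahoriZeroGL_iff (M : GL (Fin 2) F⟦X⟧) :
    M ∈ iwahoriZeroGL F ↔ PowerSeries.constantCoeff (M.1 0 0) = 1 ∧
      PowerSeries.constantCoeff (M.1 1 0) = 0 ∧ PowerSeries.constantCoeff (M.1 1 1) = 1 := by
  constructor
  · rintro ⟨u, hu⟩
    have h := fun i j => congrFun (congrFun hu i) j
    exact ⟨by simpa using h 0 0, by simpa using h 1 0, by simpa using h 1 1⟩
  · rintro ⟨h1, h2, h3⟩
    refine ⟨PowerSeries.constantCoeff (M.1 0 1), ?_⟩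
    ext i j
    fin_cases i <;> fin_cases j <;> simp [h1, h2, h3]

theorem mem_iwahoriZeroGL_iff_exists (M : GL (Fin 2) F⟦X⟧) :
    M ∈ iwahoriZeroGL F ↔ ∃ a b c d : F⟦X⟧,
      M.1 = !![1 + PowerSeries.X * a, b; PowerSeries.X * c, 1 + PowerSeries.X * d] := by
  rw [mem_iwahoriZeroGL_iff]
  constructor
  · rintro ⟨h1, h2, h3⟩
    obtain ⟨a, ha⟩ := PowerSeries.X_dvd_iff.2 (show PowerSeries.constantCoeff (M.1 0 0 - 1) = 0 by
      simp [h1])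
    obtain ⟨c, hc⟩ := PowerSeries.X_dvd_iff.2 h2
    obtain ⟨d, hd⟩ := PowerSeries.X_dvd_iff.2 (show PowerSeries.constantCoeff (M.1 1 1 - 1) = 0 by
      simp [h3])
    refine ⟨a, M.1 0 1, c, d, ?_⟩
    rw [← ha, ← hc, ← hd]
    ext i j : 2
    fin_cases i <;> fin_cases j <;> simp
  · rintro ⟨a, b, c, d, h⟩
    simp [h]

variable (F)

/-- The subgroup `I⁰` of `PGL₂(F((t)))`, the unipotent radical of the Iwahori subgroup. -/
noncomputable def iwahoriZero : Subgroup PGL(2, F⸨X⸩) :=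
  (iwahoriZeroGL F).map (integralToPGL F)

/-- The uniformizer `t` of `F((t))`. -/
noncomputable def unif : F⸨X⸩ := algebraMap F⟦X⟧ F⸨X⸩ PowerSeries.X

theorem unif_ne_zero : unif F ≠ 0 := by
  simp [unif]

/-- The matrix `(0, 1; t, 0)`. -/
noncomputable def sigmaGL : GL (Fin 2) F⸨X⸩ :=
  GeneralLinearGroup.mkOfDetNeZero !![0, 1; unif F, 0] (by simp [unif_ne_zero])

/-- The class `σ` of `(0, 1; t, 0)` in `PGL₂(F((t)))`. -/
noncomputable def sigma : PGL(2, F⸨X⸩) := ProjGenLinGroup.mk (sigmaGL F)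

/-- The subgroup `A` of `PGL₂(F((t)))` generated by `I⁰` and `σ`. -/
noncomputable def inducingGroup : Subgroup PGL(2, F⸨X⸩) :=
  iwahoriZero F ⊔ Subgroup.zpowers (sigma F)

variable {F}

theorem integralToPGL_mem {M : GL (Fin 2) F⟦X⟧} (hM : M ∈ iwahoriZeroGL F) :
    integralToPGL F M ∈ inducingGroup F :=
  Subgroup.mem_sup_left (Subgroup.mem_map_of_mem _ hM)

variable (F) in
theorem sigma_mem : sigma F ∈ inducingGroup F :=
  Subgroup.mem_sup_right (Subgroup.mem_zpowers _)

variable (F) in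
theorem sigma_mul_self : sigma F * sigma F = 1 := by
  rw [sigma, ← map_mul, ← ProjGenLinGroup.mk_one, eq_comm, ProjGenLinGroup.mk_eq_mk_iff]
  refine ⟨Units.mk0 _ (unif_ne_zero F), ?_⟩
  ext i j
  fin_cases i <;> fin_cases j <;> simp [sigmaGL, Matrix.mul_apply]

/-- The character `(1 + ta, b; tc, 1 + td) ↦ ψ(b₀ + c₀)` of the group of matrices
representing `I⁰`. -/
noncomputable def affineGenericGL (ψ : AddChar F ℂ) : iwahoriZeroGL F →* ℂ where
  toFun M := ψ (PowerSeries.coeff 0 (M.1.1 0 1) + PowerSeries.coeff 1 (M.1.1 1 0))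
  map_one' := by simp
  map_mul' := by
    rintro ⟨M, hM⟩ ⟨N, hN⟩
    obtain ⟨a, b, c, d, h⟩ := (mem_iwahoriZeroGL_iff_exists M).1 hM
    obtain ⟨a', b', c', d', h'⟩ := (mem_iwahoriZeroGL_iff_exists N).1 hN
    rw [← AddChar.map_add_eq_mul]
    congr 1
    have e : PowerSeries.X * c * (1 + PowerSeries.X * a') +
        (1 + PowerSeries.X * d) * (PowerSeries.X * c') =
        PowerSeries.X * (c + c' + PowerSeries.X * (c * a' + d * c')) := by ring
    have h1 : ∀ f : F⟦X⟧, PowerSeries.coeff 1 (PowerSeries.X * f) =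
        PowerSeries.constantCoeff f := fun f => by
      rw [← PowerSeries.coeff_zero_eq_constantCoeff_apply]
      exact PowerSeries.coeff_succ_X_mul 0 f
    simp only [MulMemClass.mk_mul_mk, Units.val_mul, h, h', Matrix.mul_fin_two,
      Matrix.of_apply, Matrix.cons_val', Matrix.cons_val_zero, Matrix.cons_val_one,
      Matrix.cons_val_fin_one, e, h1]
    simp
    ring

theorem affineGenericGL_eq_of_integralToPGL_eq (ψ : AddChar F ℂ) {M N : iwahoriZeroGL F}
    (h : integralToPGL F M = integralToPGL F N) : affineGenericGL ψ M = affineGenericGL ψ N := by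
  have key : ∀ P : iwahoriZeroGL F, integralToPGL F P = 1 → affineGenericGL ψ P = 1 := by
    intro P hP
    rw [integralToPGL, MonoidHom.comp_apply, eq_comm, ← ProjGenLinGroup.mk_one,
      ProjGenLinGroup.mk_eq_mk_iff] at hP
    obtain ⟨u, hu⟩ := hP
    have hu := fun i j => congrArg (fun M : GL (Fin 2) F⸨X⸩ => M.1 i j) hu
    have h01 : P.1.1 0 1 = 0 := by
      have h' := hu 0 1
      simp at h'
      exact HahnSeries.ofPowerSeries_injective (h'.symm.trans (map_zero _).symm)
    have h10 : P.1.1 1 0 = 0 := by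
      have h' := hu 1 0
      simp at h'
      exact HahnSeries.ofPowerSeries_injective (h'.symm.trans (map_zero _).symm)
    simp [affineGenericGL, h01, h10]
  have h1 : affineGenericGL ψ (M * N⁻¹) = 1 := key _ (by simp [h])
  calc affineGenericGL ψ M = affineGenericGL ψ (M * N⁻¹ * N) := by simp
    _ = affineGenericGL ψ N := by rw [map_mul, h1, one_mul]

/-- Conjugation by `σ` preserves the matrices representing `I⁰` and the character. -/
theorem exists_sigma_conj (ψ : AddChar F ℂ) (M : iwahoriZeroGL F) :
    ∃ N : iwahoriZeroGL F, sigma F * integralToPGL F M = integralToPGL F N * sigma F ∧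
      affineGenericGL ψ N = affineGenericGL ψ M := by
  obtain ⟨M, hM⟩ := M
  obtain ⟨a, b, c, d, h⟩ := (mem_iwahoriZeroGL_iff_exists M).1 hM
  have hdet : IsUnit (!![1 + PowerSeries.X * d, c; PowerSeries.X * b, 1 + PowerSeries.X * a] :
      Matrix (Fin 2) (Fin 2) F⟦X⟧).det := by
    rw [PowerSeries.isUnit_iff_constantCoeff]
    simp [Matrix.det_fin_two]
  let N : GL (Fin 2) F⟦X⟧ := GeneralLinearGroup.mk'' _ hdet
  have hNval : N.1 = !![1 + PowerSeries.X * d, c; PowerSeries.X * b, 1 + PowerSeries.X * a] := rfl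
  have hN : N ∈ iwahoriZeroGL F := (mem_iwahoriZeroGL_iff_exists N).2 ⟨d, c, b, a, hNval⟩
  refine ⟨⟨N, hN⟩, ?_, ?_⟩
  · simp only [sigma, integralToPGL, MonoidHom.comp_apply, ← map_mul]
    congr 1
    ext i j
    fin_cases i <;> fin_cases j <;>
      simp [sigmaGL, Matrix.mul_apply, Fin.sum_univ_two, h, hNval, unif, mul_comm]
  · have h1 : ∀ f : F⟦X⟧, PowerSeries.coeff 1 (PowerSeries.X * f) =
        PowerSeries.constantCoeff f := fun f => by
      rw [← PowerSeries.coeff_zero_eq_constantCoeff_apply]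
      exact PowerSeries.coeff_succ_X_mul 0 f
    simp [affineGenericGL, h, hNval, h1, add_comm]

/-- `σ` does not lie in `I⁰`. -/
theorem sigma_ne (M : iwahoriZeroGL F) : integralToPGL F M ≠ sigma F := by
  intro h
  rw [integralToPGL, MonoidHom.comp_apply, sigma, eq_comm, ProjGenLinGroup.mk_eq_mk_iff] at h
  obtain ⟨u, hu⟩ := h
  have h00 := congrArg (fun M : GL (Fin 2) F⸨X⸩ => M.1 0 0) hu
  have h1 := ((mem_iwahoriZeroGL_iff M.1).1 M.2).1
  simp [sigmaGL] at h00
  have h2 : M.1.1 0 0 = 0 :=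
    HahnSeries.ofPowerSeries_injective (h00.symm.trans (map_zero _).symm)
  simp [h2] at h1

theorem mem_inducingGroup {g : PGL(2, F⸨X⸩)} (hg : g ∈ inducingGroup F) :
    ∃ M : iwahoriZeroGL F, g = integralToPGL F M ∨ g = integralToPGL F M * sigma F := by
  have hσ := sigma_mul_self F
  let B : Subgroup PGL(2, F⸨X⸩) :=
    { carrier := {g | ∃ M : iwahoriZeroGL F,
        g = integralToPGL F M ∨ g = integralToPGL F M * sigma F}
      mul_mem' := by
        rintro _ _ ⟨M, rfl | rfl⟩ ⟨N, rfl | rfl⟩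
        · exact ⟨M * N, Or.inl (by simp)⟩
        · exact ⟨M * N, Or.inr (by simp [mul_assoc])⟩
        · obtain ⟨N', h, -⟩ := exists_sigma_conj 1 N
          exact ⟨M * N', Or.inr (by simp [mul_assoc, h])⟩
        · obtain ⟨N', h, -⟩ := exists_sigma_conj 1 N
          refine ⟨M * N', Or.inl ?_⟩
          rw [mul_assoc, ← mul_assoc (sigma F), h, mul_assoc, hσ]
          simp
      one_mem' := ⟨1, Or.inl (by simp)⟩
      inv_mem' := by
        rintro _ ⟨M, rfl | rfl⟩
        · exact ⟨M⁻¹, Or.inl (by simp)⟩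
        · obtain ⟨N', h, -⟩ := exists_sigma_conj 1 M⁻¹
          refine ⟨N', Or.inr ?_⟩
          rw [← h, _root_.mul_inv_rev, inv_eq_of_mul_eq_one_left hσ]
          simp }
  have hB : inducingGroup F ≤ B := by
    refine sup_le ?_ ?_
    · rintro _ ⟨M, hM, rfl⟩
      exact ⟨⟨M, hM⟩, Or.inl rfl⟩
    · rw [Subgroup.zpowers_le]
      exact ⟨1, Or.inr (by simp)⟩
  exact hB hg

/-- The character of `I⁰` extends to a character of `A` with value `1` at `σ`, in exactly
one way. -/
theorem existsUnique_affineGeneric (ψ : AddChar F ℂ) : ∃! χ : inducingGroup F →* ℂ,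
    (∀ M : iwahoriZeroGL F, χ ⟨integralToPGL F M, integralToPGL_mem M.2⟩ = affineGenericGL ψ M) ∧
      χ ⟨sigma F, sigma_mem F⟩ = 1 := by
  have hσ := sigma_mul_self F
  choose m hm using fun g : inducingGroup F => mem_inducingGroup g.2
  have spec : ∀ (g : inducingGroup F) (M : iwahoriZeroGL F),
      (g.1 = integralToPGL F M ∨ g.1 = integralToPGL F M * sigma F) →
      affineGenericGL ψ (m g) = affineGenericGL ψ M := by
    intro g M hM
    have hm := hm g
    rcases hm with h | h <;> rcases hM with h' | h'
    · exact affineGenericGL_eq_of_integralToPGL_eq ψ (h.symm.trans h')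
    · refine absurd ?_ (sigma_ne (M⁻¹ * m g))
      simp [← h, h']
    · refine absurd ?_ (sigma_ne ((m g)⁻¹ * M))
      simp [← h', h]
    · exact affineGenericGL_eq_of_integralToPGL_eq ψ (mul_right_cancel (h.symm.trans h'))
  let χ : inducingGroup F →* ℂ :=
    { toFun := fun g => affineGenericGL ψ (m g)
      map_one' := by
        rw [spec 1 1 (Or.inl (by simp)), map_one]
      map_mul' := by
        intro g g'
        obtain ⟨N, hN, hN'⟩ := exists_sigma_conj ψ (m g')
        rcases hm g with h | h <;> rcases hm g' with h' | h'
        · rw [← map_mul]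
          exact spec _ _ (Or.inl (by simp [← h, ← h']))
        · rw [← map_mul]
          refine spec _ _ (Or.inr ?_)
          rw [Subgroup.coe_mul, Subgroup.coe_mul, map_mul, mul_assoc, ← h', ← h]
        · rw [← hN', ← map_mul]
          refine spec _ _ (Or.inr ?_)
          rw [Subgroup.coe_mul, h, h', Subgroup.coe_mul, map_mul, mul_assoc, hN, mul_assoc]
        · rw [← hN', ← map_mul]
          refine spec _ _ (Or.inl ?_)
          rw [Subgroup.coe_mul, h, h', Subgroup.coe_mul, map_mul, mul_assoc,
            ← mul_assoc (sigma F), hN, mul_assoc, hσ, mul_one] }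
  refine ⟨χ, ⟨fun M => spec _ _ (Or.inl rfl), ?_⟩, ?_⟩
  · change affineGenericGL ψ (m ⟨sigma F, sigma_mem F⟩) = 1
    rw [spec _ 1 (Or.inr (by simp)), map_one]
  · rintro χ' ⟨h1, h2⟩
    ext g
    change χ' g = affineGenericGL ψ (m g)
    rcases hm g with h | h
    · rw [← h1]
      congr 1
      exact Subtype.ext h
    · have : g = ⟨integralToPGL F (m g), integralToPGL_mem (m g).2⟩ *
          ⟨sigma F, sigma_mem F⟩ := Subtype.ext h
      conv_lhs => rw [this]
      rw [map_mul, h1, h2, mul_one]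

/-- The character `χ` of `A` with `χ (1 + ta, b; tc, 1 + td) = ψ(b₀ + c₀)` and `χ(σ) = 1`. -/
noncomputable def affineGeneric (ψ : AddChar F ℂ) : inducingGroup F →* ℂ :=
  (existsUnique_affineGeneric ψ).choose

theorem affineGeneric_integralToPGL (ψ : AddChar F ℂ) (M : iwahoriZeroGL F) :
    affineGeneric ψ ⟨integralToPGL F M, integralToPGL_mem M.2⟩ =
      ψ (PowerSeries.coeff 0 (M.1.1 0 1) + PowerSeries.coeff 1 (M.1.1 1 0)) :=
  (existsUnique_affineGeneric ψ).choose_spec.1.1 M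

theorem affineGeneric_sigma (ψ : AddChar F ℂ) :
    affineGeneric ψ ⟨sigma F, sigma_mem F⟩ = 1 :=
  (existsUnique_affineGeneric ψ).choose_spec.1.2

/-- The representation `V = ind_A^{PGL₂(F((t)))} χ`. -/
noncomputable def simpleSupercuspidal (ψ : AddChar F ℂ) :
    Representation ℂ PGL(2, F⸨X⸩) (compactIndSpace (inducingGroup F) (affineGeneric ψ)) :=
  compactInd (inducingGroup F) (affineGeneric ψ)

end Group

/-! ### Valuation and topology of the Laurent series field. -/

section LaurentSeriesValuation

variable {F : Type*} [Field F]

/-! Write `f₀` for `χ` extended by zero from `A` to `G`. The group `A` is compact and `ker χ` is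
open, so `f₀` lies in `V`; its translates span `V`, and `A` acts on the line of `f₀` through `χ⁻¹`.

Cuspidality and admissibility both rest on `exists_unipotent_mem`: for every nonzero row `(p, q)`,
the one-parameter unipotent group `1 + w (q, -p)ᵀ (p, q)` contains an element of `A` on which `χ` is
not `1`. Conjugating `U(K)` by `g⁻¹` gives the group attached to the bottom row of `g`. Hence some
`u` in `U(K)` multiplies `g f₀` by a scalar other than `1`, and an invariant functional kills `g
f₀`. For admissibility, scale `g` so that its largest entry is `1`. If the determinant is very
small, the element of `A` attached to the row containing that entry is conjugated by `g` into a
given open subgroup `H`, which forces `H`-fixed functions to vanish at `g`. The remaining `g` form a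
compact set, which meets only finitely many cosets of `A`.

Irreducibility is Mackey's criterion. Averaging over `A` puts into any nonzero subrepresentation a
function that is `χ`-equivariant on both sides and nonzero at `1`. If such functions are supported
on `A`, this one is a multiple of `f₀`, which generates `V`. Elimination and `σ` reduce the support
condition to the matrices `diag(y, 1)`; outside `A`, comparing `χ` on a unipotent element with its
value on the conjugate by `diag(y, 1)` gives vanishing. -/

theorem unif_eq_coe : unif F = HahnSeries.ofPowerSeries ℤ F PowerSeries.X := rfl

theorem valued_unif : Valued.v (unif F) = WithZero.exp (-1 : ℤ) := by
  have h := LaurentSeries.valuation_X_pow F 1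
  rwa [pow_one] at h

theorem valued_unif_pow (n : ℕ) : Valued.v (unif F ^ n) = WithZero.exp (-(n : ℤ)) :=
  LaurentSeries.valuation_X_pow F n

theorem valued_unif_lt_one : Valued.v (unif F) < 1 := by
  rw [valued_unif, ← WithZero.exp_zero, WithZero.exp_lt_exp]
  norm_num

theorem valued_lt_one_iff (x : F⸨X⸩) : Valued.v x < 1 ↔ Valued.v x ≤ WithZero.exp (-1 : ℤ) := by
  have h := WithZero.lt_mul_exp_iff_le (x := Valued.v x) (y := WithZero.exp (-1 : ℤ)) (by simp)
  rwa [← WithZero.exp_add, neg_add_cancel, WithZero.exp_zero] at h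

theorem valued_lt_one_iff_coeff {x : F⸨X⸩} (hx : Valued.v x ≤ 1) :
    Valued.v x < 1 ↔ x.coeff 0 = 0 := by
  rw [valued_lt_one_iff, LaurentSeries.valuation_le_iff_coeff_lt_eq_zero]
  rw [← WithZero.exp_zero, ← neg_zero, LaurentSeries.valuation_le_iff_coeff_lt_eq_zero] at hx
  refine ⟨fun h => h 0 one_pos, fun h n hn => ?_⟩
  rcases (Int.lt_add_one_iff.1 (by simpa using hn) : n ≤ 0).lt_or_eq with h' | rfl
  · exact hx n h'
  · exact h

/-- The valuation is discrete, so the strict bound already places `x` in `t²O`. -/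
theorem coeff_one_eq_zero {x : F⸨X⸩} (hx : Valued.v x < Valued.v (unif F)) : x.coeff 1 = 0 := by
  have ht := unif_ne_zero F
  have h1 : Valued.v (x / unif F) < 1 := by
    rw [map_div₀]
    exact (div_lt_one₀ (zero_lt_iff.2 ((Valuation.ne_zero_iff _).2 ht))).2 hx
  rw [valued_lt_one_iff] at h1
  have h2 : Valued.v x ≤ WithZero.exp (-2 : ℤ) := by
    have : x = x / unif F * unif F := by field_simp
    rw [this, map_mul, valued_unif]
    calc _ ≤ WithZero.exp (-1 : ℤ) * WithZero.exp (-1 : ℤ) := by gcongr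
      _ = _ := by rw [← WithZero.exp_add]; rfl
  exact LaurentSeries.coeff_zero_of_lt_valuation F h2 (by norm_num)

theorem valued_C_le_one (x : F) : Valued.v (HahnSeries.C x : F⸨X⸩) ≤ 1 :=
  (LaurentSeries.val_le_one_iff_eq_coe F _).2 ⟨PowerSeries.C x, by simp⟩

theorem coeff_one_C_mul_unif (x : F) : (HahnSeries.C x * unif F).coeff 1 = x := by
  rw [HahnSeries.C_mul_eq_smul, HahnSeries.coeff_smul, unif_eq_coe]
  simp

theorem coeff_zero_mul_C (y : F⸨X⸩) (x : F) :
    (y * HahnSeries.C x).coeff 0 = y.coeff 0 * x := by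
  rw [mul_comm, HahnSeries.C_mul_eq_smul, HahnSeries.coeff_smul, smul_eq_mul, mul_comm]

theorem isOpen_valued_lt (y : F⸨X⸩) : IsOpen {x : F⸨X⸩ | Valued.v x < Valued.v y} := by
  simpa only [Valuation.restrict_lt_iff] using
    Valued.isOpen_ball F⸨X⸩ ((Valued.v (R := F⸨X⸩)).restrict y)

theorem isClosed_valued_le (y : F⸨X⸩) : IsClosed {x : F⸨X⸩ | Valued.v y ≤ Valued.v x} := by
  have := (isOpen_valued_lt y).isClosed_compl
  simpa [Set.compl_ofPred] using this

theorem exists_valued_le_imp_mem {s : Set F⸨X⸩} (hs : s ∈ nhds (0 : F⸨X⸩)) :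
    ∃ y : F⸨X⸩, y ≠ 0 ∧ ∀ x, Valued.v x ≤ Valued.v y → x ∈ s := by
  obtain ⟨γ, hγ⟩ := Valued.mem_nhds.1 hs
  obtain ⟨n, hn⟩ := WithZero.exists_exp_neg_natCast_lt
    (x := MonoidWithZeroHom.ValueGroup₀.embedding γ.1) (by simp)
  refine ⟨unif F ^ n, pow_ne_zero _ (unif_ne_zero F), fun x hx => hγ ?_⟩
  rw [Set.mem_ofPred_eq, Valuation.restrict_lt_iff_lt_embedding, sub_zero]
  exact (hx.trans_eq (valued_unif_pow n)).trans_lt hn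

/-- The integers of `F((t))` are compact if `F` is finite. -/
theorem isCompact_valued_le_one [Finite F] : IsCompact {x : F⸨X⸩ | Valued.v x ≤ 1} := by
  let _ : TopologicalSpace F := ⊥
  have : DiscreteTopology F := ⟨rfl⟩
  let φ : (ℕ → F) → F⸨X⸩ := fun c => HahnSeries.ofPowerSeries ℤ F (PowerSeries.mk c)
  have hφ : Continuous φ := by
    rw [continuous_iff_continuousAt]
    intro c s hs
    have hs' : (fun x => φ c + x) ⁻¹' s ∈ nhds (0 : F⸨X⸩) :=
      (continuous_const.add continuous_id).continuousAt (by simpa using hs)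
    obtain ⟨y, hy, hys⟩ := exists_valued_le_imp_mem hs'
    obtain ⟨n, hn⟩ := WithZero.exists_exp_neg_natCast_lt ((Valuation.ne_zero_iff _).2 hy)
    -- A cylinder: sequences agreeing with `c` in the first `n` places give series congruent modulo
    -- `tⁿ`. Compactness then comes from Tychonoff, as `F` is finite and discrete.
    have hU : {d : ℕ → F | ∀ i < n, d i = c i} ∈ nhds c := by
      have h : ∀ i, ∀ᶠ d in nhds c, d i = c i := fun i => by
        have h := (continuous_apply (A := fun _ : ℕ => F) i).tendsto c
        rwa [nhds_discrete F, Filter.tendsto_pure] at h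
      exact (Filter.eventually_all_finite (Set.finite_lt_nat n)).2 fun i _ => h i
    refine Filter.mem_map.2 ?_
    filter_upwards [hU] with d hd
    have h1 : φ d - φ c = HahnSeries.ofPowerSeries ℤ F (PowerSeries.mk d - PowerSeries.mk c) := by
      simp [φ]
    have h2 : φ d - φ c ∈ (fun x => φ c + x) ⁻¹' s := by
      refine hys _ (le_trans ?_ hn.le)
      rw [h1, LaurentSeries.intValuation_le_iff_coeff_lt_eq_zero]
      intro i hi
      have := hd i (by exact_mod_cast hi)
      simpa [sub_eq_zero] using this
    simpa using h2
  have h := isCompact_range hφ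
  convert h using 1
  ext x
  rw [Set.mem_ofPred_eq, LaurentSeries.val_le_one_iff_eq_coe]
  constructor
  · rintro ⟨f, rfl⟩
    have hf : (PowerSeries.mk fun n => PowerSeries.coeff n f) = f := by
      ext n
      simp
    exact ⟨fun n => PowerSeries.coeff n f, congrArg (HahnSeries.ofPowerSeries ℤ F) hf⟩
  · rintro ⟨c, rfl⟩
    exact ⟨_, rfl⟩

end LaurentSeriesValuation

/-! ### Matrix coordinates on the projective linear group. -/

section PGL

variable {K : Type*} [Field K]

/-- The class in `PGL₂(K)` of the matrix `(a, b; c, d)`. -/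
noncomputable def pglMk (a b c d : K) (h : a * d - b * c ≠ 0) : PGL(2, K) :=
  ProjGenLinGroup.mk (GeneralLinearGroup.mkOfDetNeZero !![a, b; c, d] (by rwa [det_fin_two_of]))

theorem pglMk_mul {a b c d a' b' c' d' : K} (h : a * d - b * c ≠ 0) (h' : a' * d' - b' * c' ≠ 0) :
    pglMk a b c d h * pglMk a' b' c' d' h' =
      pglMk (a * a' + b * c') (a * b' + b * d') (c * a' + d * c') (c * b' + d * d')
        (by convert mul_ne_zero h h' using 1; ring) := by
  rw [pglMk, pglMk, ← map_mul]
  refine congrArg _ (Units.ext ?_)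
  simp [GeneralLinearGroup.mkOfDetNeZero]

theorem pglMk_eq_of_smul {a b c d a' b' c' d' : K} (h : a * d - b * c ≠ 0)
    (h' : a' * d' - b' * c' ≠ 0) {r : K} (hr : r ≠ 0) (ha : a' = a * r) (hb : b' = b * r)
    (hc : c' = c * r) (hd : d' = d * r) : pglMk a b c d h = pglMk a' b' c' d' h' := by
  subst ha hb hc hd
  refine ProjGenLinGroup.mk_eq_mk_iff.2 ⟨Units.mk0 r hr, ?_⟩
  ext i j
  fin_cases i <;> fin_cases j <;> simp [GeneralLinearGroup.mkOfDetNeZero]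

theorem pglMk_one (h : (1 : K) * 1 - 0 * 0 ≠ 0) : pglMk 1 0 0 1 h = 1 := by
  refine (congrArg _ (Units.ext ?_)).trans (map_one (ProjGenLinGroup.mk (n := Fin 2) (R := K)))
  simp [GeneralLinearGroup.mkOfDetNeZero, one_fin_two]

theorem mk_eq_pglMk (M : GL (Fin 2) K) : ∃ h, ProjGenLinGroup.mk M =
    pglMk (M.1 0 0) (M.1 0 1) (M.1 1 0) (M.1 1 1) h := by
  refine ⟨?_, congrArg _ (Units.ext (eta_fin_two M.1))⟩
  rw [← det_fin_two]
  exact ((isUnit_iff_isUnit_det _).1 M.isUnit).ne_zero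

theorem exists_eq_pglMk (g : PGL(2, K)) : ∃ a b c d h, g = pglMk (K := K) a b c d h := by
  obtain ⟨M, rfl⟩ := ProjGenLinGroup.mk_surjective g
  obtain ⟨h, e⟩ := mk_eq_pglMk M
  exact ⟨_, _, _, _, h, e⟩

theorem pglMk_mem_unipotentPGL (u : K) (h : (1 : K) * 1 - u * 0 ≠ 0) :
    pglMk 1 u 0 1 h ∈ unipotentPGL K :=
  Subgroup.mem_map_of_mem _ ⟨u, rfl⟩

theorem isOpenQuotientMap_mk [TopologicalSpace K] [IsTopologicalRing K] :
    IsOpenQuotientMap (ProjGenLinGroup.mk : GL (Fin 2) K → PGL(2, K)) :=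
  QuotientGroup.isOpenQuotientMap_mk

/-- `GL` carries the topology of units, so the entries of the inverse matrix must be continuous too;
this uses continuity of inversion in `K`. -/
theorem continuous_pglMk [TopologicalSpace K] [IsTopologicalDivisionRing K] {X : Type*}
    [TopologicalSpace X] {a b c d : X → K} (ha : Continuous a) (hb : Continuous b)
    (hc : Continuous c) (hd : Continuous d) (h : ∀ x, a x * d x - b x * c x ≠ 0) :
    Continuous fun x => pglMk (a x) (b x) (c x) (d x) (h x) := by
  refine isOpenQuotientMap_mk.continuous.comp (Units.continuous_iff.2 ⟨?_, ?_⟩)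
  · refine continuous_matrix fun i j => ?_
    fin_cases i <;> fin_cases j <;> simpa [GeneralLinearGroup.mkOfDetNeZero]
  · have hi : Continuous fun x => (a x * d x - b x * c x)⁻¹ :=
      ((ha.mul hd).sub (hb.mul hc)).inv₀ h
    simp only [coe_units_inv, inv_def, GeneralLinearGroup.mkOfDetNeZero, adjugate_fin_two_of,
      Ring.inverse_eq_inv', GeneralLinearGroup.val_mk', det_fin_two_of]
    refine continuous_matrix fun i j => ?_
    fin_cases i <;> fin_cases j <;> simp <;> fun_prop

end PGL

/-! ### Topology of the inducing group and of its character. -/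

section InducingGroup

variable {F : Type*} [Field F]

theorem exists_mem_inducingGroup (ψ : AddChar F ℂ) {a b c d : F⸨X⸩} (h : a * d - b * c ≠ 0)
    (ha : Valued.v (a - 1) < 1) (hb : Valued.v b ≤ 1) (hc : Valued.v c < 1)
    (hd : Valued.v (d - 1) < 1) : ∃ hm : pglMk a b c d h ∈ inducingGroup F,
      affineGeneric ψ ⟨_, hm⟩ = ψ (b.coeff 0 + c.coeff 1) := by
  have key : ∀ x : F⸨X⸩, Valued.v x < 1 → ∃ f : F⟦X⟧, PowerSeries.constantCoeff f = 0 ∧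
      HahnSeries.ofPowerSeries ℤ F f = x := by
    intro x hx
    obtain ⟨f, hf⟩ := (LaurentSeries.val_le_one_iff_eq_coe F x).1 hx.le
    refine ⟨f, ?_, hf⟩
    rw [valued_lt_one_iff_coeff hx.le, ← hf] at hx
    rw [← PowerSeries.coeff_zero_eq_constantCoeff_apply]
    exact (LaurentSeries.coeff_coe_powerSeries f 0).symm.trans hx
  obtain ⟨P, hP, hPa⟩ := key _ ha
  obtain ⟨Q, hQ⟩ := (LaurentSeries.val_le_one_iff_eq_coe F b).1 hb
  obtain ⟨R, hR, hRc⟩ := key _ hc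
  obtain ⟨S, hS, hSd⟩ := key _ hd
  have hdet : IsUnit (!![1 + P, Q; R, 1 + S] : Matrix (Fin 2) (Fin 2) F⟦X⟧).det := by
    rw [PowerSeries.isUnit_iff_constantCoeff]
    simp [det_fin_two, hP, hR, hS]
  let M : GL (Fin 2) F⟦X⟧ := GeneralLinearGroup.mk'' _ hdet
  have hM : M ∈ iwahoriZeroGL F := by
    rw [mem_iwahoriZeroGL_iff]
    simp [M, GeneralLinearGroup.mk'', nonsingInvUnit, hP, hR, hS]
  have e : pglMk a b c d h = integralToPGL F M := by
    rw [integralToPGL, MonoidHom.comp_apply]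
    refine congrArg _ (Units.ext ?_)
    have ha' : a = 1 + HahnSeries.ofPowerSeries ℤ F P := by rw [hPa]; ring
    have hd' : d = 1 + HahnSeries.ofPowerSeries ℤ F S := by rw [hSd]; ring
    ext1 i j
    fin_cases i <;> fin_cases j <;>
      simp [M, GeneralLinearGroup.mkOfDetNeZero, ← hQ, ← hRc, ha', hd']
  have hm : pglMk a b c d h ∈ inducingGroup F := e ▸ integralToPGL_mem hM
  refine ⟨hm, ?_⟩
  have e' : (⟨_, hm⟩ : inducingGroup F) = ⟨integralToPGL F M, integralToPGL_mem hM⟩ :=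
    Subtype.ext e
  rw [e']
  refine (affineGeneric_integralToPGL ψ ⟨M, hM⟩).trans ?_
  rw [← hQ, ← hRc]
  congr 2
  · exact (LaurentSeries.coeff_coe_powerSeries Q 0).symm
  · exact (LaurentSeries.coeff_coe_powerSeries R 1).symm

/-- The kernel of the affine generic character, as a subgroup of `PGL₂(F((t)))`. -/
noncomputable def affineGenericKer (ψ : AddChar F ℂ) : Subgroup PGL(2, F⸨X⸩) :=
  (affineGeneric ψ).ker.map (inducingGroup F).subtype

theorem mem_affineGenericKer {ψ : AddChar F ℂ} {g : PGL(2, F⸨X⸩)} :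
    g ∈ affineGenericKer ψ ↔ ∃ h : g ∈ inducingGroup F, affineGeneric ψ ⟨g, h⟩ = 1 := by
  simp [affineGenericKer, MonoidHom.mem_ker]

/-- A matrix near `1` has `b` in `tO` and `c` in `t²O`, so both coefficients seen by `χ` vanish.
Openness passes through the quotient map from `GL`. -/
theorem isOpen_affineGenericKer (ψ : AddChar F ℂ) :
    IsOpen (affineGenericKer ψ : Set PGL(2, F⸨X⸩)) := by
  rw [← (isOpenQuotientMap_mk (K := F⸨X⸩)).isQuotientMap.isOpen_preimage]
  refine Subgroup.isOpen_of_mem_nhds ((affineGenericKer ψ).comap ProjGenLinGroup.mk) (g := 1) ?_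
  have hcont : ∀ i j, Continuous fun M : GL (Fin 2) F⸨X⸩ => M.1 i j :=
    fun i j => Units.continuous_val.matrix_elem i j
  have hopen : ∀ (i j : Fin 2) (r : F⸨X⸩), r ≠ 0 → ∀ᶠ M : GL (Fin 2) F⸨X⸩ in nhds 1,
      Valued.v (M.1 i j - (1 : GL (Fin 2) F⸨X⸩).1 i j) < Valued.v r := by
    intro i j r hr
    refine ((hcont i j).sub continuous_const).continuousAt.eventually
      ((isOpen_valued_lt r).mem_nhds ?_)
    simpa [zero_lt_iff] using hr
  filter_upwards [hopen 0 0 1 one_ne_zero, hopen 0 1 1 one_ne_zero,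
    hopen 1 0 (unif F) (unif_ne_zero F), hopen 1 1 1 one_ne_zero] with M ha hb hc hd
  obtain ⟨h, e⟩ := mk_eq_pglMk M
  simp only [Units.val_one, one_apply_eq, map_one, ne_eq, zero_ne_one, one_ne_zero,
    not_false_eq_true, one_apply_ne, sub_zero] at ha hb hc hd
  obtain ⟨hm, hχ⟩ := exists_mem_inducingGroup ψ h ha hb.le (hc.trans valued_unif_lt_one) hd
  change ProjGenLinGroup.mk M ∈ affineGenericKer ψ
  rw [e, mem_affineGenericKer]
  refine ⟨hm, ?_⟩
  rw [hχ, (valued_lt_one_iff_coeff hb.le).1 hb, coeff_one_eq_zero hc, add_zero,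
    AddChar.map_zero_eq_one]

variable (F) in
theorem isOpen_inducingGroup : IsOpen (inducingGroup F : Set PGL(2, F⸨X⸩)) :=
  Subgroup.isOpen_mono (fun _ hg => (mem_affineGenericKer.1 hg).1)
    (isOpen_affineGenericKer (1 : AddChar F ℂ))

/-- The classes of the integral matrices with determinant at least `r` in absolute value. -/
def integralClasses (r : F⸨X⸩) : Set PGL(2, F⸨X⸩) :=
  {g | ∃ a b c d h, Valued.v a ≤ 1 ∧ Valued.v b ≤ 1 ∧ Valued.v c ≤ 1 ∧ Valued.v d ≤ 1 ∧
    Valued.v r ≤ Valued.v (a * d - b * c) ∧ g = pglMk (K := F⸨X⸩) a b c d h}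

/-- The lower bound on the determinant cuts out a closed subset of the compact `O⁴`, on which the
class map is defined and continuous. -/
theorem isCompact_integralClasses [Finite F] {r : F⸨X⸩} (hr : r ≠ 0) :
    IsCompact (integralClasses r) := by
  let O : Set F⸨X⸩ := {x | Valued.v x ≤ 1}
  have hO : IsCompact O := isCompact_valued_le_one
  let S : Set (F⸨X⸩ × F⸨X⸩ × F⸨X⸩ × F⸨X⸩) :=
    (O ×ˢ O ×ˢ O ×ˢ O) ∩ {x | Valued.v r ≤ Valued.v (x.1 * x.2.2.2 - x.2.1 * x.2.2.1)}
  have hS : IsCompact S := (hO.prod (hO.prod (hO.prod hO))).inter_right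
    ((isClosed_valued_le r).preimage
      (f := fun x : F⸨X⸩ × F⸨X⸩ × F⸨X⸩ × F⸨X⸩ => x.1 * x.2.2.2 - x.2.1 * x.2.2.1) (by fun_prop))
  have hdet : ∀ x : S, x.1.1 * x.1.2.2.2 - x.1.2.1 * x.1.2.2.1 ≠ 0 := by
    intro x h0
    have hx : Valued.v r ≤ Valued.v (x.1.1 * x.1.2.2.2 - x.1.2.1 * x.1.2.2.1) := x.2.2
    rw [h0, map_zero, le_zero_iff, Valuation.zero_iff] at hx
    exact hr hx
  have : CompactSpace S := isCompact_iff_compactSpace.1 hS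
  have hc := isCompact_range (continuous_pglMk (K := F⸨X⸩) (X := S) (a := fun x => x.1.1)
    (b := fun x => x.1.2.1) (c := fun x => x.1.2.2.1) (d := fun x => x.1.2.2.2)
    (by fun_prop) (by fun_prop) (by fun_prop) (by fun_prop) hdet)
  convert hc using 1
  ext g
  constructor
  · rintro ⟨a, b, c, d, h, ha, hb, hc, hd, hr, rfl⟩
    exact ⟨⟨(a, b, c, d), ⟨ha, hb, hc, hd⟩, hr⟩, rfl⟩
  · rintro ⟨⟨⟨a, b, c, d⟩, ⟨ha, hb, hc, hd⟩, hr⟩, rfl⟩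
    exact ⟨a, b, c, d, _, ha, hb, hc, hd, hr, rfl⟩

variable (F) in
theorem sigma_eq_pglMk : ∃ h, sigma F = pglMk 0 1 (unif F) 0 h :=
  ⟨by simp [unif_ne_zero], rfl⟩

-- As an open subgroup `A` is closed. It has integral representatives whose determinant is a unit on
-- `I⁰` and a unit times `t` on `I⁰σ`, so it lies in `integralClasses (unif F)`.
variable (F) in
theorem isCompact_inducingGroup [Finite F] : IsCompact (inducingGroup F : Set PGL(2, F⸨X⸩)) := by
  refine (isCompact_integralClasses (unif_ne_zero F)).of_isClosed_subset
    (Subgroup.isClosed_of_isOpen _ (isOpen_inducingGroup F)) fun g hg => ?_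
  have hint : ∀ f : F⟦X⟧, Valued.v (algebraMap F⟦X⟧ F⸨X⸩ f) ≤ 1 := fun f =>
    (LaurentSeries.val_le_one_iff_eq_coe F _).2 ⟨f, rfl⟩
  obtain ⟨⟨M, hM⟩, hg⟩ := mem_inducingGroup hg
  obtain ⟨h, e⟩ := mk_eq_pglMk (GeneralLinearGroup.map (algebraMap F⟦X⟧ F⸨X⸩) M)
  change integralToPGL F M = _ at e
  have hdet : Valued.v (algebraMap F⟦X⟧ F⸨X⸩ M.1.det) = 1 := by
    obtain ⟨u, hu⟩ := (isUnit_iff_isUnit_det _).1 M.isUnit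
    rw [← hu]
    refine le_antisymm (hint _) ?_
    have h1 : algebraMap F⟦X⟧ F⸨X⸩ u * algebraMap F⟦X⟧ F⸨X⸩ (u⁻¹ : F⟦X⟧ˣ) = 1 := by
      rw [← map_mul, Units.mul_inv, map_one]
    have h2 := mul_le_of_le_one_right' (a := Valued.v (algebraMap F⟦X⟧ F⸨X⸩ u))
      (hint (u⁻¹ : F⟦X⟧ˣ))
    rwa [← map_mul, h1, map_one] at h2
  rw [det_fin_two, map_sub, map_mul, map_mul] at hdet
  rcases hg with rfl | rfl
  · refine ⟨_, _, _, _, h, hint _, hint _, hint _, hint _, ?_, e⟩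
    exact valued_unif_lt_one.le.trans_eq hdet.symm
  · obtain ⟨hs, es⟩ := sigma_eq_pglMk F
    rw [e, es, pglMk_mul]
    refine ⟨_, _, _, _, _, ?_, ?_, ?_, ?_, ?_, rfl⟩
    · rw [mul_zero, zero_add]
      exact hint (M.1 0 1 * PowerSeries.X) |>.trans_eq' (by rw [map_mul]; rfl)
    · simpa using hint _
    · rw [mul_zero, zero_add]
      exact hint (M.1 1 1 * PowerSeries.X) |>.trans_eq' (by rw [map_mul]; rfl)
    · simpa using hint _
    · apply le_of_eq
      rw [← mul_one (Valued.v (unif F)), ← hdet, ← map_mul, ← Valuation.map_neg]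
      congr 1
      simp
      ring

end InducingGroup

/-! ### Compact induction from a compact open subgroup, and Mackey's criterion. -/

section CompactInduction

variable {G : Type*} [Group G] {A : Subgroup G} {χ : A →* ℂ}

theorem character_ne_zero (χ : A →* ℂ) (a : A) : χ a ≠ 0 := fun h => by
  have h1 : χ (a * a⁻¹) = 1 := by rw [mul_inv_cancel, map_one]
  rw [map_mul, h, zero_mul] at h1
  exact zero_ne_one h1

open Classical in
/-- The extension by zero of a character of a subgroup. -/
noncomputable def extendByZero (χ : A →* ℂ) (g : G) : ℂ :=
  if h : g ∈ A then χ ⟨g, h⟩ else 0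

theorem extendByZero_of_mem {g : G} (h : g ∈ A) : extendByZero χ g = χ ⟨g, h⟩ := dif_pos h

theorem extendByZero_of_notMem {g : G} (h : g ∉ A) : extendByZero χ g = 0 := dif_neg h

theorem extendByZero_mul_coe (g : G) (a : A) :
    extendByZero χ (g * a) = χ a * extendByZero χ g := by
  by_cases h : g ∈ A
  · rw [extendByZero_of_mem h, extendByZero_of_mem (A.mul_mem h a.2), mul_comm, ← map_mul]
    rfl
  · rw [extendByZero_of_notMem h, extendByZero_of_notMem, mul_zero]
    rwa [A.mul_mem_cancel_right a.2]

theorem extendByZero_coe_mul (a : A) (g : G) :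
    extendByZero χ (a * g) = χ a * extendByZero χ g := by
  by_cases h : g ∈ A
  · rw [extendByZero_of_mem h, extendByZero_of_mem (A.mul_mem a.2 h), ← map_mul]
    rfl
  · rw [extendByZero_of_notMem h, extendByZero_of_notMem, mul_zero]
    rwa [A.mul_mem_cancel_left a.2]

theorem extendByZero_one : extendByZero χ (1 : G) = 1 := by
  rw [extendByZero_of_mem A.one_mem]
  exact map_one χ

theorem mem_ker_map_subtype {g : G} :
    g ∈ χ.ker.map A.subtype ↔ ∃ h : g ∈ A, χ ⟨g, h⟩ = 1 := by
  simp [MonoidHom.mem_ker]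

theorem exists_eq_out_mul (A : Subgroup G) (g : G) :
    ∃ a : A, g = (QuotientGroup.mk g : G ⧸ A).out * a :=
  ⟨⟨_, QuotientGroup.leftRel_apply.1 (Quotient.exact (Quotient.out_eq (g : G ⧸ A)))⟩, by simp⟩

variable [TopologicalSpace G]

theorem extendByZero_mem (hA : IsCompact (A : Set G))
    (hχ : IsOpen (χ.ker.map A.subtype : Set G)) : extendByZero χ ∈ compactIndSpace A χ := by
  refine ⟨⟨⟨_, hχ, fun g u hu => ?_⟩, A, hA, fun g hg => ?_⟩, extendByZero_mul_coe⟩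
  · obtain ⟨h, h1⟩ := mem_ker_map_subtype.1 hu
    rw [extendByZero_mul_coe g ⟨u, h⟩, h1, one_mul]
  · by_contra h
    exact hg (extendByZero_of_notMem h)

variable [IsTopologicalGroup G]

theorem compactInd_apply (h : G) (f : compactIndSpace A χ) (g : G) :
    (compactInd A χ h f).1 g = f.1 (h⁻¹ * g) := rfl

theorem finite_cosets_of_isCompact (hA : IsOpen (A : Set G)) {C : Set G} (hC : IsCompact C) :
    ((QuotientGroup.mk : G → G ⧸ A) '' C).Finite := by
  have := QuotientGroup.discreteTopology hA
  exact (hC.image QuotientGroup.continuous_mk).finite_of_discrete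

/-- Compact induction is spanned by the translates of the extended character. -/
theorem span_range_translates (hA : IsCompact (A : Set G)) (hA' : IsOpen (A : Set G))
    (hχ : IsOpen (χ.ker.map A.subtype : Set G)) :
    Submodule.span ℂ (Set.range fun g => compactInd A χ g ⟨_, extendByZero_mem hA hχ⟩) = ⊤ := by
  rw [eq_top_iff]
  rintro f -
  obtain ⟨⟨-, C, hC, hfC⟩, hf⟩ := f.2
  let s := (finite_cosets_of_isCompact hA' hC).toFinset
  have key : f = ∑ q ∈ s, f.1 q.out • compactInd A χ q.out ⟨_, extendByZero_mem hA hχ⟩ := by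
    ext g
    obtain ⟨a, ha⟩ := exists_eq_out_mul A g
    have e : ∀ q : G ⧸ A, q ≠ QuotientGroup.mk g → extendByZero χ (q.out⁻¹ * g) = 0 := by
      intro q hq
      refine extendByZero_of_notMem fun h => hq ?_
      rw [← QuotientGroup.eq] at h
      rw [← h, QuotientGroup.out_eq']
    simp only [Submodule.coe_sum, Submodule.coe_smul, Finset.sum_apply, Pi.smul_apply,
      compactInd_apply, smul_eq_mul]
    rw [Finset.sum_eq_single (QuotientGroup.mk g : G ⧸ A)]
    · conv_lhs => rw [ha, hf]
      have : (QuotientGroup.mk g : G ⧸ A).out⁻¹ * g = a := by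
        conv_lhs => rw [ha]
        simp
      rw [this, extendByZero_of_mem a.2, mul_comm]
    · intro q _ hq
      rw [e q hq, mul_zero]
    · intro hq
      have h0 : f.1 g = 0 := by
        by_contra h
        exact hq ((Set.Finite.mem_toFinset _).2 ⟨g, hfC h, rfl⟩)
      rw [ha, hf, mul_eq_zero, or_iff_right (character_ne_zero χ a)] at h0
      rw [h0, zero_mul]
  rw [key]
  exact Submodule.sum_mem _ fun q _ => Submodule.smul_mem _ _ (Submodule.subset_span ⟨_, rfl⟩)

/-- The definition of the space gives invariance under right translation only, while the action is
on the left. But `f₀` is left invariant under `ker χ`, so `g f₀` is fixed by the conjugate of `ker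
χ` by `g`, and these vectors span. -/
theorem compactInd_isSmoothRep (hA : IsCompact (A : Set G)) (hA' : IsOpen (A : Set G))
    (hχ : IsOpen (χ.ker.map A.subtype : Set G)) : IsSmoothRep (compactInd A χ) := by
  intro v
  have hv : v ∈ Submodule.span ℂ
      (Set.range fun g => compactInd A χ g ⟨_, extendByZero_mem hA hχ⟩) := by
    rw [span_range_translates hA hA' hχ]
    trivial
  induction hv using Submodule.span_induction with
  | mem x hx =>
    obtain ⟨g, rfl⟩ := hx
    refine ⟨(χ.ker.map A.subtype).comap (MulAut.conj g⁻¹).toMonoidHom, hχ.preimage ?_, ?_⟩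
    · change Continuous fun u => g⁻¹ * u * g⁻¹⁻¹
      fun_prop
    · intro u hu
      obtain ⟨h, h1⟩ := mem_ker_map_subtype.1 (inv_mem (Subgroup.mem_comap.1 hu))
      ext y
      simp only [compactInd_apply]
      have e : g⁻¹ * (u⁻¹ * y) =
          (⟨((MulAut.conj g⁻¹).toMonoidHom u)⁻¹, h⟩ : A) * (g⁻¹ * y) := by
        simp [mul_assoc]
      rw [e, extendByZero_coe_mul, h1, one_mul]
  | zero => exact ⟨⊤, isOpen_univ, fun u _ => map_zero _⟩
  | add x y _ _ hx hy =>
    obtain ⟨U, hU, hx⟩ := hx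
    obtain ⟨U', hU', hy⟩ := hy
    exact ⟨U ⊓ U', hU.inter hU', fun u hu => by rw [map_add, hx u hu.1, hy u hu.2]⟩
  | smul c x _ hx =>
    obtain ⟨U, hU, hx⟩ := hx
    exact ⟨U, hU, fun u hu => by rw [map_smul, hx u hu]⟩

/-- If `χ` is nontrivial on `A ∩ g⁻¹ U g` for all `g` outside a compact set, then the space of
`U`-fixed vectors in the compact induction of `χ` is finite-dimensional. -/
theorem finiteDimensional_fixedVectors (hA' : IsOpen (A : Set G)) {U : Subgroup G} {C : Set G}
    (hC : IsCompact C) (h : ∀ g ∉ C, ∃ a : A, g * a * g⁻¹ ∈ U ∧ χ a ≠ 1) :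
    FiniteDimensional ℂ (fixedVectors (compactInd A χ) U) := by
  have := (finite_cosets_of_isCompact hA' hC).to_subtype
  let T := (QuotientGroup.mk : G → G ⧸ A) '' C
  let φ : fixedVectors (compactInd A χ) U →ₗ[ℂ] (T → ℂ) :=
    { toFun := fun f q => f.1.1 q.1.out
      map_add' := fun _ _ => rfl
      map_smul' := fun _ _ => rfl }
  have hzero : ∀ (f : fixedVectors (compactInd A χ) U), ∀ g ∉ C, f.1.1 g = 0 := by
    intro f g hgC
    by_contra hg
    obtain ⟨a, ha, ha1⟩ := h g hgC
    -- Invariance under `g a g⁻¹` gives `f g = f (g a) = χ a * f g`.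
    have h1 := congrArg (fun f' => f'.1 g) (f.2 _ (inv_mem ha))
    simp only [compactInd_apply, inv_inv, inv_mul_cancel_right] at h1
    rw [f.1.2.2] at h1
    exact ha1 (mul_right_cancel₀ hg (h1.trans (one_mul _).symm))
  have hφ : Function.Injective φ := fun f f' hff' => by
    ext g
    by_cases hgC : g ∈ C
    · obtain ⟨a, ha⟩ := exists_eq_out_mul A g
      have h0 := congrFun hff' ⟨QuotientGroup.mk g, g, hgC, rfl⟩
      rw [ha, f.1.2.2, f'.1.2.2]
      exact congrArg _ h0
    · rw [hzero f g hgC, hzero f' g hgC]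
  exact FiniteDimensional.of_injective φ hφ

/-- The projection of `f` to the `χ⁻¹`-isotypic part: a vector in the span of the translates of `f`
on which `A` acts by `χ⁻¹`, with the same value at `1` up to a nonzero integer. -/
theorem exists_isotypic_mem (hA : IsCompact (A : Set G)) (hχ : IsOpen (χ.ker.map A.subtype : Set G))
    (hs : IsSmoothRep (compactInd A χ)) (W : Subrepresentation (compactInd A χ))
    {f : compactIndSpace A χ} (hf : f ∈ W) (hf1 : f.1 1 ≠ 0) :
    ∃ e ∈ W, e.1 1 ≠ 0 ∧ ∀ (a : A) (g : G), e.1 (a * g) = χ a * e.1 g := by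
  obtain ⟨U, hU, hUf⟩ := hs f
  -- On `N` the character is trivial and `f` is fixed, so `χ(a) a f` depends only on the class of
  -- `a`. Since `N` is open in the compact `A`, the averaging integral becomes a finite sum.
  let N : Subgroup A := (χ.ker.map A.subtype ⊓ U).subgroupOf A
  have hN : IsOpen (N : Set A) := (hχ.inter hU).preimage continuous_subtype_val
  have : CompactSpace A := isCompact_iff_compactSpace.1 hA
  have := N.quotient_finite_of_isOpen hN
  have := Fintype.ofFinite (A ⧸ N)
  let φ : A → compactIndSpace A χ := fun a => χ a • compactInd A χ a f
  have hφ : ∀ a b : A, a⁻¹ * b ∈ N → φ a = φ b := by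
    intro a b hab
    obtain ⟨h1, h2⟩ := Subgroup.mem_subgroupOf.1 hab
    obtain ⟨h1, h3⟩ := mem_ker_map_subtype.1 h1
    have e : b = a * (a⁻¹ * b) := by simp
    have h3 : χ (a⁻¹ * b) = 1 := h3
    change _ = χ b • compactInd A χ b f
    rw [e, map_mul, h3, mul_one, Subgroup.coe_mul, map_mul, Module.End.mul_apply, hUf _ h2]
  let Φ : A ⧸ N → compactIndSpace A χ :=
    Quotient.lift φ fun a b hab => hφ a b (QuotientGroup.leftRel_apply.1 hab)
  have hΦ : ∀ a : A, Φ (QuotientGroup.mk a) = φ a := fun _ => rfl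
  have heval : ∀ (g : G), (∑ q, Φ q).1 g = ∑ q, (Φ q).1 g := fun g => by
    simp [Finset.sum_apply]
  refine ⟨∑ q, Φ q, ?_, ?_, ?_⟩
  · refine W.toSubmodule.sum_mem fun q _ => ?_
    induction q using QuotientGroup.induction_on with
    | H a => exact W.toSubmodule.smul_mem _ (W.apply_mem_toSubmodule _ hf)
  · rw [heval]
    -- Right equivariance gives `χ(a) f(a⁻¹) = f(1)`, so the terms cannot cancel at `1`.
    have h1 : ∀ q, (Φ q).1 1 = f.1 1 := fun q => by
      induction q using QuotientGroup.induction_on with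
      | H a =>
        change χ a * f.1 ((a : G)⁻¹ * 1) = f.1 1
        rw [mul_one, ← one_mul (a : G)⁻¹, ← Subgroup.coe_inv, f.2.2, ← mul_assoc, ← map_mul,
          mul_inv_cancel, map_one, one_mul]
    simp [h1, hf1]
  · intro a g
    rw [heval, heval, Finset.mul_sum,
      ← Equiv.sum_comp (MulAction.toPerm a : Equiv.Perm (A ⧸ N))]
    refine Finset.sum_congr rfl fun q _ => ?_
    induction q using QuotientGroup.induction_on with
    | H b =>
      change χ (a * b) * f.1 (((a * b : A) : G)⁻¹ * (a * g)) = χ a * (χ b * f.1 ((b : G)⁻¹ * g))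
      rw [map_mul, mul_assoc]
      simp [mul_assoc]

/-- Mackey's criterion: if every function that transforms by `χ` on both sides is supported on
`A`, then the compact induction of `χ` is irreducible. -/
theorem compactInd_isIrreducible (hA : IsCompact (A : Set G)) (hA' : IsOpen (A : Set G))
    (hχ : IsOpen (χ.ker.map A.subtype : Set G))
    (h : ∀ f : G → ℂ, (∀ (a : A) (g : G), f (a * g) = χ a * f g) →
      (∀ (g : G) (a : A), f (g * a) = χ a * f g) → ∀ g ∉ A, f g = 0) :
    (compactInd A χ).IsIrreducible := by
  let f₀ : compactIndSpace A χ := ⟨_, extendByZero_mem hA hχ⟩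
  have hf₀ : f₀ ≠ 0 := fun h0 => by
    have h1 := congrArg (fun f : compactIndSpace A χ => f.1 1) h0
    exact one_ne_zero (extendByZero_one.symm.trans h1)
  have : Nontrivial (Subrepresentation (compactInd A χ)) := by
    refine ⟨⊥, ⊤, fun h0 => hf₀ ?_⟩
    have : f₀ ∈ (⊥ : Subrepresentation (compactInd A χ)) := by
      rw [h0]
      trivial
    exact this
  refine IsSimpleOrder.mk fun W => or_iff_not_imp_left.2 fun hW => ?_
  obtain ⟨f, hfW, hf⟩ : ∃ f ∈ W, f ≠ 0 := by
    by_contra! hn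
    refine hW (Subrepresentation.toSubmodule_injective ?_)
    exact (Submodule.eq_bot_iff _).2 hn
  obtain ⟨g, hg⟩ : ∃ g, f.1 g ≠ 0 := by
    by_contra! hn
    exact hf (Subtype.ext (funext hn))
  obtain ⟨e, heW, he1, he⟩ := exists_isotypic_mem hA hχ (compactInd_isSmoothRep hA hA' hχ) W
    (W.apply_mem_toSubmodule g⁻¹ hfW) (by simpa [compactInd_apply] using hg)
  have hef : e = e.1 1 • f₀ := by
    ext x
    change e.1 x = e.1 1 * extendByZero χ x
    by_cases hx : x ∈ A
    · have := he ⟨x, hx⟩ 1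
      rw [mul_one] at this
      rw [extendByZero_of_mem hx, mul_comm, ← this]
    · rw [extendByZero_of_notMem hx, mul_zero, h e.1 he e.2.2 x hx]
  have hf₀W : f₀ ∈ W := by
    have h1 : (e.1 1)⁻¹ • e ∈ W := W.toSubmodule.smul_mem _ heW
    have h2 : (e.1 1)⁻¹ • e = f₀ := by
      conv_lhs => rw [hef, smul_smul]
      rw [← hef, inv_mul_cancel₀ he1, one_smul]
    rwa [h2] at h1
  refine Subrepresentation.toSubmodule_injective (eq_top_iff.2 ?_)
  refine (span_range_translates hA hA' hχ).symm.le.trans (Submodule.span_le.2 ?_)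
  rintro _ ⟨g, rfl⟩
  exact W.apply_mem_toSubmodule g hf₀W

end CompactInduction

/-! ### Unipotent elements of the inducing group; cuspidality and admissibility. -/

section SimpleSupercuspidal

variable {F : Type*} [Field F]

theorem valued_le_mul_unif {x y : F⸨X⸩} (h : Valued.v x < Valued.v y) :
    Valued.v x ≤ Valued.v (y * unif F) := by
  have hy : y ≠ 0 := fun h0 => by simp [h0] at h
  have h1 : Valued.v (x / y) < 1 := by
    rw [map_div₀]
    exact (div_lt_one₀ (zero_lt_iff.2 ((Valuation.ne_zero_iff _).2 hy))).2 h
  rw [valued_lt_one_iff, ← valued_unif (F := F)] at h1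
  have e : x = y * (x / y) := by field_simp
  rw [e, map_mul, map_mul]
  gcongr

theorem valued_mul_unif_lt {y : F⸨X⸩} (hy : y ≠ 0) : Valued.v (y * unif F) < Valued.v y := by
  rw [map_mul]
  exact mul_lt_of_lt_one_right (zero_lt_iff.2 ((Valuation.ne_zero_iff _).2 hy)) valued_unif_lt_one

theorem valued_div_lt_one {x y : F⸨X⸩} (h : Valued.v x < Valued.v y) : Valued.v (x / y) < 1 := by
  rw [map_div₀]
  exact (div_lt_one₀ (zero_le.trans_lt h)).2 h

theorem valued_div_le_one {x y : F⸨X⸩} (h : Valued.v x ≤ Valued.v y) : Valued.v (x / y) ≤ 1 := by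
  rw [map_div₀]
  exact div_le_one_of_le₀ h zero_le

theorem valued_mul_lt_of_le_one_left {x y : F⸨X⸩} {r : WithZero (Multiplicative ℤ)}
    (hx : Valued.v x ≤ 1) (hy : Valued.v y < r) : Valued.v (x * y) < r := by
  rw [map_mul]
  exact (mul_le_of_le_one_left' hx).trans_lt hy

theorem exists_addChar_ne_one {ψ : AddChar F ℂ} (hψ : ψ ≠ 1) : ∃ x, ψ x ≠ 1 := by
  by_contra! h
  exact hψ (by ext x; simp [h x])

theorem exists_unipotent_mem_of_valued (ψ : AddChar F ℂ) {p q w : F⸨X⸩}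
    (hpq : Valued.v (w * (p * q)) < 1) (hp : Valued.v (w * p ^ 2) < 1)
    (hq : Valued.v (w * q ^ 2) ≤ 1) : ∃ h, ∃ hm :
      pglMk (1 + w * (p * q)) (w * q ^ 2) (-(w * p ^ 2)) (1 - w * (p * q)) h ∈ inducingGroup F,
      affineGeneric ψ ⟨_, hm⟩ = ψ ((w * q ^ 2).coeff 0 + (-(w * p ^ 2)).coeff 1) := by
  have h : (1 + w * (p * q)) * (1 - w * (p * q)) - w * q ^ 2 * -(w * p ^ 2) ≠ 0 := by
    convert one_ne_zero (α := F⸨X⸩) using 1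
    ring
  have e : ∀ x : F⸨X⸩, Valued.v (1 - x - 1) = Valued.v x := fun x => by
    rw [← Valuation.map_neg _ x]
    congr 1
    ring
  have e' : ∀ x : F⸨X⸩, Valued.v (1 + x - 1) = Valued.v x := fun x => by
    congr 1
    ring
  have hp' : Valued.v (-(w * p ^ 2)) < 1 := (Valuation.map_neg _ _).trans_lt hp
  exact ⟨h, exists_mem_inducingGroup ψ h ((e' _).trans_lt hpq) hq hp' ((e _).trans_lt hpq)⟩

theorem div_sq_mul_mul {K : Type*} [Field K] (x p : K) {q : K} (hq : q ≠ 0) :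
    x / q ^ 2 * (p * q) = x * (p / q) := by
  field_simp

theorem div_sq_mul_sq {K : Type*} [Field K] (x p q : K) :
    x / q ^ 2 * p ^ 2 = x * ((p / q) * (p / q)) := by
  ring

/-- Every nontrivial unipotent one-parameter subgroup of `PGL₂(F((t)))` meets the inducing group in
an element on which the character is nontrivial. -/
theorem exists_unipotent_mem {ψ : AddChar F ℂ} (hψ : ψ ≠ 1) {p q : F⸨X⸩} (hpq : p ≠ 0 ∨ q ≠ 0) :
    ∃ w, Valued.v (w * p ^ 2) ≤ 1 ∧ Valued.v (w * q ^ 2) ≤ 1 ∧ ∃ h, ∃ hm :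
      pglMk (1 + w * (p * q)) (w * q ^ 2) (-(w * p ^ 2)) (1 - w * (p * q)) h ∈ inducingGroup F,
      affineGeneric ψ ⟨_, hm⟩ ≠ 1 := by
  obtain ⟨x, hx⟩ := exists_addChar_ne_one hψ
  have hC := valued_C_le_one x
  rcases lt_or_ge (Valued.v p) (Valued.v q) with h | h
  · have hq : q ≠ 0 := fun h0 => not_lt_zero (by rwa [h0, map_zero] at h)
    have hr := valued_div_lt_one h
    -- The upper right entry is made equal to `x`. As `p / q` lies in `tO`, the lower left entry
    -- lies in `t²O` and does not contribute to `χ`.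
    obtain ⟨w, e1, e2, e3⟩ : ∃ w : F⸨X⸩, w * q ^ 2 = HahnSeries.C x ∧
        w * (p * q) = HahnSeries.C x * (p / q) ∧
        w * p ^ 2 = HahnSeries.C x * ((p / q) * (p / q)) :=
      ⟨HahnSeries.C x / q ^ 2, div_mul_cancel₀ _ (pow_ne_zero 2 hq), div_sq_mul_mul _ _ hq,
        div_sq_mul_sq _ _ _⟩
    have h1 : Valued.v (w * q ^ 2) ≤ 1 := e1 ▸ hC
    have h2 : Valued.v (w * (p * q)) < 1 := e2 ▸ valued_mul_lt_of_le_one_left hC hr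
    have h3 : Valued.v (w * p ^ 2) < Valued.v (unif F) := by
      rw [e3]
      refine valued_mul_lt_of_le_one_left hC ?_
      have hr' := hr
      rw [valued_lt_one_iff, ← valued_unif (F := F)] at hr'
      refine (valued_mul_unif_lt (unif_ne_zero F)).trans_le' ?_
      rw [map_mul, map_mul]
      gcongr
    have h4 := h3.trans valued_unif_lt_one
    obtain ⟨hdet, hm, hχ⟩ := exists_unipotent_mem_of_valued ψ h2 h4 h1
    refine ⟨w, h4.le, h1, hdet, hm, ?_⟩
    rw [hχ, coeff_one_eq_zero (by rwa [Valuation.map_neg]), e1]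
    simpa using hx
  · have hp : p ≠ 0 := fun h0 => by
      rw [h0, map_zero, le_zero_iff, Valuation.zero_iff] at h
      exact hpq.elim (fun h' => h' h0) fun h' => h' h
    have hr := valued_div_le_one h
    have ht := valued_unif_lt_one (F := F)
    -- Now the lower left entry `-(w * p ^ 2)` is `x t`, while the upper right entry lies in `tO`
    -- and contributes nothing.
    obtain ⟨w, e1, e2, e3⟩ : ∃ w : F⸨X⸩, w * p ^ 2 = -(HahnSeries.C x * unif F) ∧
        w * (p * q) = -(HahnSeries.C x * unif F) * (q / p) ∧
        w * q ^ 2 = -(HahnSeries.C x * unif F) * ((q / p) * (q / p)) :=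
      ⟨-(HahnSeries.C x * unif F) / p ^ 2, div_mul_cancel₀ _ (pow_ne_zero 2 hp),
        by rw [mul_comm p, div_sq_mul_mul _ _ hp], div_sq_mul_sq _ _ _⟩
    have h1 : Valued.v (-(HahnSeries.C x * unif F)) < 1 := by
      rw [Valuation.map_neg]
      exact valued_mul_lt_of_le_one_left hC ht
    have h2 : Valued.v (w * (p * q)) < 1 := by
      rw [e2, mul_comm]
      exact valued_mul_lt_of_le_one_left hr h1
    have h3 : Valued.v (w * q ^ 2) < 1 := by
      rw [e3, mul_comm, mul_assoc]
      exact valued_mul_lt_of_le_one_left hr (valued_mul_lt_of_le_one_left hr h1)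
    rw [← e1] at h1
    obtain ⟨hdet, hm, hχ⟩ := exists_unipotent_mem_of_valued ψ h2 h1 h3.le
    refine ⟨w, h1.le, h3.le, hdet, hm, ?_⟩
    rw [hχ, (valued_lt_one_iff_coeff h3.le).1 h3, e1, neg_neg, coeff_one_C_mul_unif, zero_add]
    exact hx

/-- For `g = (a, b; c, d)`, the conjugate `g⁻¹ E₁₂ g` is `(d, -c)ᵀ (c, d) / det g`; the factor `det
g` in the parameter clears the denominator. -/
theorem upper_mul_pglMk {K : Type*} [Field K] {a b c d w : K} (h : a * d - b * c ≠ 0)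
    (h1 : (1 : K) * 1 - w * (a * d - b * c) * 0 ≠ 0)
    (h2 : (1 + w * (c * d)) * (1 - w * (c * d)) - w * d ^ 2 * -(w * c ^ 2) ≠ 0) :
    pglMk 1 (w * (a * d - b * c)) 0 1 h1 * pglMk a b c d h = pglMk a b c d h *
      pglMk (1 + w * (c * d)) (w * d ^ 2) (-(w * c ^ 2)) (1 - w * (c * d)) h2 := by
  rw [pglMk_mul, pglMk_mul]
  congr 1 <;> ring

theorem lower_mul_pglMk {K : Type*} [Field K] {a b c d w : K} (h : a * d - b * c ≠ 0)
    (h1 : (1 : K) * 1 - 0 * -(w * (a * d - b * c)) ≠ 0)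
    (h2 : (1 + w * (a * b)) * (1 - w * (a * b)) - w * b ^ 2 * -(w * a ^ 2) ≠ 0) :
    pglMk 1 0 (-(w * (a * d - b * c))) 1 h1 * pglMk a b c d h = pglMk a b c d h *
      pglMk (1 + w * (a * b)) (w * b ^ 2) (-(w * a ^ 2)) (1 - w * (a * b)) h2 := by
  rw [pglMk_mul, pglMk_mul]
  congr 1 <;> ring

theorem simpleSupercuspidal_isQuasiCuspidal [Finite F] {ψ : AddChar F ℂ} (hψ : ψ ≠ 1) :
    IsQuasiCuspidal (simpleSupercuspidal ψ) := by
  intro l hl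
  refine LinearMap.ext_on (span_range_translates (isCompact_inducingGroup F)
    (isOpen_inducingGroup F) (isOpen_affineGenericKer ψ)) ?_
  rintro _ ⟨g, rfl⟩
  obtain ⟨a, b, c, d, h, rfl⟩ := exists_eq_pglMk g
  obtain ⟨w, -, -, h2, hm, hχ⟩ := exists_unipotent_mem hψ (p := c) (q := d) (by
    by_contra! h0
    simp [h0.1, h0.2] at h)
  have h1 : (1 : F⸨X⸩) * 1 - w * (a * d - b * c) * 0 ≠ 0 := by simp
  have hl := hl _ (pglMk_mem_unipotentPGL _ h1) (compactInd _ _ (pglMk a b c d h)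
    ⟨_, extendByZero_mem (isCompact_inducingGroup F) (isOpen_affineGenericKer ψ)⟩)
  set f₀ : compactIndSpace (inducingGroup F) (affineGeneric ψ) :=
    ⟨_, extendByZero_mem (isCompact_inducingGroup F) (isOpen_affineGenericKer ψ)⟩
  set α : inducingGroup F := ⟨_, hm⟩ with hα
  have hf₀ : compactInd _ _ (α : PGL(2, F⸨X⸩)) f₀ = affineGeneric ψ α⁻¹ • f₀ := by
    ext x
    exact extendByZero_coe_mul α⁻¹ x
  change l (compactInd _ _ (pglMk 1 _ 0 1 h1) (compactInd _ _ (pglMk a b c d h) f₀)) = _ at hl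
  rw [← Module.End.mul_apply, ← map_mul, upper_mul_pglMk h h1 h2, map_mul, Module.End.mul_apply,
    hf₀, map_smul, map_smul, smul_eq_mul] at hl
  by_contra hne
  refine hχ ?_
  -- If `l (g f₀) ≠ 0`, invariance forces `χ(α⁻¹) = 1`.
  have h3 := mul_right_cancel₀ hne (hl.trans (one_mul _).symm)
  rw [← mul_one (affineGeneric ψ α)]
  nth_rewrite 1 [← h3]
  rw [← map_mul, mul_inv_cancel, map_one]

theorem exists_eq_pglMk_normalized (g : PGL(2, F⸨X⸩)) : ∃ a b c d h, g = pglMk a b c d h ∧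
    Valued.v a ≤ 1 ∧ Valued.v b ≤ 1 ∧ Valued.v c ≤ 1 ∧ Valued.v d ≤ 1 ∧
    ((a = 1 ∨ b = 1) ∨ (c = 1 ∨ d = 1)) := by
  obtain ⟨a, b, c, d, h, rfl⟩ := exists_eq_pglMk g
  obtain ⟨i, hi⟩ := Finite.exists_max fun i => Valued.v (![a, b, c, d] i)
  have ha := hi 0
  have hb := hi 1
  have hc := hi 2
  have hd := hi 3
  set m := ![a, b, c, d] i with hm
  have hm0 : m ≠ 0 := fun h0 => by
    rw [h0] at ha hb hc hd
    simp only [map_zero, le_zero_iff, Valuation.zero_iff] at ha hb hc hd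
    simp at ha hb
    simp [ha, hb] at h
  refine ⟨a / m, b / m, c / m, d / m, ?_, pglMk_eq_of_smul h _ (inv_ne_zero hm0)
    (div_eq_mul_inv _ _) (div_eq_mul_inv _ _) (div_eq_mul_inv _ _) (div_eq_mul_inv _ _),
    valued_div_le_one ha, valued_div_le_one hb, valued_div_le_one hc, valued_div_le_one hd, ?_⟩
  · have e : a / m * (d / m) - b / m * (c / m) = (a * d - b * c) / m ^ 2 := by
      field_simp
    rw [e]
    exact div_ne_zero h (pow_ne_zero _ hm0)
  · simp only [div_eq_one_iff_eq hm0]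
    fin_cases i
    · exact Or.inl (Or.inl hm.symm)
    · exact Or.inl (Or.inr hm.symm)
    · exact Or.inr (Or.inl hm.symm)
    · exact Or.inr (Or.inr hm.symm)

theorem simpleSupercuspidal_isAdmissibleRep [Finite F] {ψ : AddChar F ℂ} (hψ : ψ ≠ 1) :
    IsAdmissibleRep (simpleSupercuspidal ψ) := by
  refine ⟨compactInd_isSmoothRep (isCompact_inducingGroup F) (isOpen_inducingGroup F)
    (isOpen_affineGenericKer ψ), fun U hU => ?_⟩
  have hu : ∀ u : F⸨X⸩, (1 : F⸨X⸩) * 1 - u * 0 ≠ 0 := fun u => by simp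
  have hl : ∀ u : F⸨X⸩, (1 : F⸨X⸩) * 1 - 0 * u ≠ 0 := fun u => by simp
  have hnhds : {u | pglMk 1 u 0 1 (hu u) ∈ U} ∩ {u | pglMk 1 0 u 1 (hl u) ∈ U} ∈
      nhds (0 : F⸨X⸩) := by
    refine Filter.inter_mem ?_ ?_
    · refine (hU.preimage (continuous_pglMk continuous_const continuous_id continuous_const
        continuous_const hu)).mem_nhds ?_
      change pglMk 1 0 0 1 _ ∈ U
      rw [pglMk_one]
      exact U.one_mem
    · refine (hU.preimage (continuous_pglMk continuous_const continuous_const continuous_id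
        continuous_const hl)).mem_nhds ?_
      change pglMk 1 0 0 1 _ ∈ U
      rw [pglMk_one]
      exact U.one_mem
  obtain ⟨r, hr, hrU⟩ := exists_valued_le_imp_mem hnhds
  refine finiteDimensional_fixedVectors (isOpen_inducingGroup F) (isCompact_integralClasses hr) ?_
  intro g hg
  obtain ⟨a, b, c, d, h, rfl, ha, hb, hc, hd, h1⟩ := exists_eq_pglMk_normalized g
  -- Outside the compact set the determinant is smaller than the radius `r` within which both
  -- unipotent groups lie in `U`.
  have hD : Valued.v (a * d - b * c) < Valued.v r := by
    by_contra! hD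
    exact hg ⟨a, b, c, d, h, ha, hb, hc, hd, hD, rfl⟩
  rcases h1 with h1 | h1
  · obtain ⟨w, hw1, hw2, h2, hm, hχ⟩ := exists_unipotent_mem hψ (p := a) (q := b)
      (by rcases h1 with rfl | rfl <;> simp)
    -- One of `p`, `q` equals `1`, so one of the two bounds from `exists_unipotent_mem` is a bound
    -- on `w` itself.
    have hw : Valued.v w ≤ 1 := by
      rcases h1 with rfl | rfl
      · simpa using hw1
      · simpa using hw2
    refine ⟨⟨_, hm⟩, ?_, hχ⟩
    rw [← lower_mul_pglMk h (hl _) h2, mul_inv_cancel_right]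
    refine (hrU _ ?_).2
    rw [Valuation.map_neg]
    exact (valued_mul_lt_of_le_one_left hw hD).le
  · obtain ⟨w, hw1, hw2, h2, hm, hχ⟩ := exists_unipotent_mem hψ (p := c) (q := d)
      (by rcases h1 with rfl | rfl <;> simp)
    have hw : Valued.v w ≤ 1 := by
      rcases h1 with rfl | rfl
      · simpa using hw1
      · simpa using hw2
    refine ⟨⟨_, hm⟩, ?_, hχ⟩
    rw [← upper_mul_pglMk h (hu _) h2, mul_inv_cancel_right]
    exact (hrU _ (valued_mul_lt_of_le_one_left hw hD).le).1

/-! ### Double cosets of the inducing group, and irreducibility. -/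

theorem exists_upper_mem (ψ : AddChar F ℂ) {u : F⸨X⸩} (hu : Valued.v u ≤ 1)
    (h : (1 : F⸨X⸩) * 1 - u * 0 ≠ 0) : ∃ hm : pglMk 1 u 0 1 h ∈ inducingGroup F,
      affineGeneric ψ ⟨_, hm⟩ = ψ (u.coeff 0) := by
  simpa using exists_mem_inducingGroup ψ h (by simp) hu (by simp) (by simp)

theorem exists_lower_mem (ψ : AddChar F ℂ) {u : F⸨X⸩} (hu : Valued.v u < 1)
    (h : (1 : F⸨X⸩) * 1 - 0 * u ≠ 0) : ∃ hm : pglMk 1 0 u 1 h ∈ inducingGroup F,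
      affineGeneric ψ ⟨_, hm⟩ = ψ (u.coeff 1) := by
  simpa using exists_mem_inducingGroup ψ h (by simp) (by simp) hu (by simp)

/-- Elimination with a dominant diagonal entry as pivot. Upper multipliers need only be integral and
lower ones must lie in `tO`, hence the weak inequality for `b` and the strict one for `c`. With
pivot `a` the diagonal part is `diag(a, det / a)`, with pivot `d` it is `diag(det / d, d)`; scaling
gives `y`. -/
theorem exists_decomposition_of_pivot {a b c d : F⸨X⸩} (h : a * d - b * c ≠ 0)
    (hp : (Valued.v b ≤ Valued.v a ∧ Valued.v c < Valued.v a) ∨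
      (Valued.v b ≤ Valued.v d ∧ Valued.v c < Valued.v d)) :
    ∃ y h', ∃ α ∈ inducingGroup F, ∃ β ∈ inducingGroup F,
      pglMk a b c d h = α * pglMk y 0 0 1 h' * β := by
  rcases hp with ⟨hb, hc⟩ | ⟨hb, hc⟩
  · have ha : a ≠ 0 := fun h0 => by simp [h0] at hc
    refine ⟨a ^ 2 / (a * d - b * c), by simp [h, ha], _,
      (exists_lower_mem 1 (valued_div_lt_one hc) (by simp)).1, _,
      (exists_upper_mem 1 (valued_div_le_one hb) (by simp)).1, ?_⟩
    rw [pglMk_mul, pglMk_mul]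
    refine (pglMk_eq_of_smul _ _ (div_ne_zero h ha) ?_ ?_ ?_ ?_).symm <;>
      obtain ⟨D, hD⟩ : ∃ D, D = a * d - b * c := ⟨_, rfl⟩ <;> rw [← hD] at h ⊢ <;>
      field_simp <;> first | ring1 | linear_combination -a * hD
  · have hd : d ≠ 0 := fun h0 => by simp [h0] at hc
    refine ⟨(a * d - b * c) / d ^ 2, by simp [h, hd], _,
      (exists_upper_mem 1 (valued_div_le_one hb) (by simp)).1, _,
      (exists_lower_mem 1 (valued_div_lt_one hc) (by simp)).1, ?_⟩
    rw [pglMk_mul, pglMk_mul]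
    refine (pglMk_eq_of_smul _ _ hd ?_ ?_ ?_ ?_).symm <;> field_simp <;> ring

/-- The diagonal matrices represent all double cosets of the inducing group. -/
theorem exists_decomposition (g : PGL(2, F⸨X⸩)) :
    ∃ y h, ∃ α ∈ inducingGroup F, ∃ β ∈ inducingGroup F, g = α * pglMk y 0 0 1 h * β := by
  obtain ⟨a, b, c, d, h, rfl⟩ := exists_eq_pglMk g
  by_cases hp : (Valued.v b ≤ Valued.v a ∧ Valued.v c < Valued.v a) ∨
      (Valued.v b ≤ Valued.v d ∧ Valued.v c < Valued.v d)
  · exact exists_decomposition_of_pivot h hp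
  have ht := unif_ne_zero F
  have h' : b * unif F * c - a * (d * unif F) ≠ 0 := by
    convert mul_ne_zero (neg_ne_zero.2 h) ht using 1
    ring
  -- Right multiplication by `σ` gives `(b t, a; d t, c)`. With no diagonal pivot in `g`, either `b`
  -- strictly dominates `a` and `d`, or `c` weakly does; discreteness turns this into a pivot here.
  have hp' : (Valued.v a ≤ Valued.v (b * unif F) ∧ Valued.v (d * unif F) < Valued.v (b * unif F)) ∨
      (Valued.v a ≤ Valued.v c ∧ Valued.v (d * unif F) < Valued.v c) := by
    by_cases hb : Valued.v a < Valued.v b ∧ Valued.v d < Valued.v b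
    · refine Or.inl ⟨valued_le_mul_unif hb.1, ?_⟩
      rw [map_mul, map_mul]
      exact mul_lt_mul_of_pos_right hb.2 (zero_lt_iff.2 ((Valuation.ne_zero_iff _).2 ht))
    · have hac : Valued.v a ≤ Valued.v c ∧ Valued.v d ≤ Valued.v c := by
        by_contra hac
        grind
      refine Or.inr ⟨hac.1, ?_⟩
      by_cases hd : d = 0
      · have hc : c ≠ 0 := fun h0 => by simp [h0, hd] at h
        simpa [hd, zero_lt_iff] using hc
      · exact (valued_mul_unif_lt hd).trans_le hac.2
  obtain ⟨y, hy, α, hα, β, hβ, e⟩ := exists_decomposition_of_pivot h' hp'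
  refine ⟨y, hy, α, hα, β * sigma F, mul_mem hβ (sigma_mem F), ?_⟩
  rw [← mul_assoc, ← e]
  obtain ⟨hs, es⟩ := sigma_eq_pglMk F
  rw [es, pglMk_mul]
  refine pglMk_eq_of_smul _ _ ht ?_ ?_ ?_ ?_ <;> ring

/-- Functions that transform by the character on both sides vanish at the diagonal matrices outside
the inducing group. -/
theorem eq_zero_of_diagonal {ψ : AddChar F ℂ} (hψ : ψ ≠ 1) {f : PGL(2, F⸨X⸩) → ℂ}
    (hl : ∀ (a : inducingGroup F) g, f (a * g) = affineGeneric ψ a * f g)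
    (hr : ∀ g (a : inducingGroup F), f (g * a) = affineGeneric ψ a * f g) {y : F⸨X⸩}
    (h : y * 1 - 0 * 0 ≠ 0) (hy : pglMk y 0 0 1 h ∉ inducingGroup F) :
    f (pglMk y 0 0 1 h) = 0 := by
  have hy0 : y ≠ 0 := by simpa using h
  have key : ∀ α β : inducingGroup F, pglMk y 0 0 1 h * α = β * pglMk y 0 0 1 h →
      affineGeneric ψ α ≠ affineGeneric ψ β → f (pglMk y 0 0 1 h) = 0 := by
    intro α β e hne
    have e' := congrArg f e
    rw [hr, hl] at e'
    by_contra h0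
    exact hne (mul_right_cancel₀ h0 e')
  rcases le_or_gt (Valued.v y) 1 with hy1 | hy1
  -- Moving the upper unipotent with entry `x` across `diag(y, 1)` replaces `x` by `y x`. The two
  -- characters of `x` agree only if `y₀ = 1`, and then `diag(y, 1)` lies in `I⁰`.
  · obtain ⟨x, hx⟩ : ∃ x, ψ x ≠ ψ (y.coeff 0 * x) := by
      by_contra! hall
      by_cases hc : y.coeff 0 = 1
      · refine hy (exists_mem_inducingGroup 1 h ?_ (by simp) (by simp) (by simp)).1
        rw [valued_lt_one_iff_coeff ((Valuation.map_sub _ _ _).trans (by simpa using hy1))]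
        simp [hc]
      · obtain ⟨x, hx⟩ := exists_addChar_ne_one hψ
        have hc' : 1 - y.coeff 0 ≠ 0 := sub_ne_zero.2 (Ne.symm hc)
        refine hx ?_
        have := hall (x / (1 - y.coeff 0))
        have e : x = x / (1 - y.coeff 0) - y.coeff 0 * (x / (1 - y.coeff 0)) := by
          field_simp
        rw [e, AddChar.map_sub_eq_div, ← this, div_self]
        intro h0
        have := AddChar.map_add_eq_mul ψ (x / (1 - y.coeff 0)) (-(x / (1 - y.coeff 0)))
        rw [h0] at this
        simp at this
    have hC := valued_C_le_one x
    have hyC : Valued.v (y * HahnSeries.C x) ≤ 1 := by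
      rw [map_mul]
      exact mul_le_one' hy1 hC
    obtain ⟨hα, eα⟩ := exists_upper_mem ψ hC (by simp)
    obtain ⟨hβ, eβ⟩ := exists_upper_mem ψ hyC (by simp)
    refine key ⟨_, hα⟩ ⟨_, hβ⟩ ?_ ?_
    · rw [pglMk_mul, pglMk_mul]
      congr 1 <;> ring
    · rw [eα, eβ, coeff_zero_mul_C]
      simpa using hx
  -- For `|y| > 1` the lower unipotent with entry `x t` is used: crossing `diag(y, 1)` divides the
  -- entry by `y`, which pushes it into `t²O`, where `χ` is trivial.
  · obtain ⟨x, hx⟩ := exists_addChar_ne_one hψ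
    have hz : Valued.v (HahnSeries.C x * unif F) < 1 :=
      valued_mul_lt_of_le_one_left (valued_C_le_one x) valued_unif_lt_one
    have hz' : Valued.v (HahnSeries.C x * (y⁻¹ * unif F)) < Valued.v (unif F) := by
      refine valued_mul_lt_of_le_one_left (valued_C_le_one x) ?_
      rw [map_mul, map_inv₀]
      exact mul_lt_of_lt_one_left (zero_lt_iff.2 ((Valuation.ne_zero_iff _).2 (unif_ne_zero F)))
        (inv_lt_one_of_one_lt₀ hy1)
    obtain ⟨hα, eα⟩ := exists_lower_mem ψ hz (by simp)
    obtain ⟨hβ, eβ⟩ := exists_lower_mem ψ (hz'.trans valued_unif_lt_one) (by simp)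
    refine key ⟨_, hα⟩ ⟨_, hβ⟩ ?_ ?_
    · rw [pglMk_mul, pglMk_mul]
      congr 1 <;> field_simp <;> ring
    · rw [eα, eβ, coeff_one_C_mul_unif, coeff_one_eq_zero hz', AddChar.map_zero_eq_one]
      exact hx

theorem simpleSupercuspidal_isIrreducible [Finite F] {ψ : AddChar F ℂ} (hψ : ψ ≠ 1) :
    (simpleSupercuspidal ψ).IsIrreducible := by
  refine compactInd_isIrreducible (isCompact_inducingGroup F) (isOpen_inducingGroup F)
    (isOpen_affineGenericKer ψ) fun f hl hr g hg => ?_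
  obtain ⟨y, h, α, hα, β, hβ, rfl⟩ := exists_decomposition g
  have h0 : f (pglMk y 0 0 1 h) = 0 :=
    eq_zero_of_diagonal hψ hl hr h fun hm => hg (mul_mem (mul_mem hα hm) hβ)
  rw [hr _ ⟨β, hβ⟩, hl ⟨α, hα⟩, h0, mul_zero, mul_zero]

end SimpleSupercuspidal

theorem mainTheorem5 {F : Type*} [Field F] [Finite F] (ψ : AddChar F ℂ) (hψ : ψ ≠ 1) :
    (simpleSupercuspidal ψ).IsIrreducible ∧ IsCuspidalRep (simpleSupercuspidal ψ) :=
  ⟨simpleSupercuspidal_isIrreducible hψ,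
    simpleSupercuspidal_isAdmissibleRep hψ, simpleSupercuspidal_isQuasiCuspidal hψ⟩
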